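/- A *streaming algorithm* $\mathcal M$ reads real samples $X_1,X_2,\dots$ one at a time. After $t=0,1,2,\dots$ samples, if it is still running, it either continues or halts and releases a real estimate $\hat\mu$, and this decision is a (measurable) function of the first $t$ samples and of the internal randomness of $\mathcal M$, which is independent of the samples. For $R,\varepsilon>0$, $\mathcal M$ is *$\varepsilon$-differentially private* if for any two streams $S,S'$ with entries in $[-R,R]$ that differ in a single timestep, every $T$, and every measurable set $\mathcal O$ of sequences of decisions through timestep $T$, $\Pr[\mathcal M(S)\in\mathcal O]\le e^{\varepsilon}\Pr[\mathcal M(S')\in\mathcal O]$. It is an *$(\alpha,\beta)$-stopping rule* for the range $[-R,R]$ if for every probability distribution supported in $[-R,R]$ with mean $m\neq 0$, when run on i.i.d. samples from that distribution, the probability that $\mathcal M$ halts and releases some $\hat\mu$ with $|\hat\mu-m|>\alpha|m|$ is less than $\beta$ (running forever is not counted as an error, so rules that halt almost surely are in particular included). **Theorem.** There is an absolute constant $c>0$ such that the following holds for all $R>0$, $\varepsilon>0$, $\alpha\in(0,1)$ and $\beta\in(0,\tfrac14)$. Let $\mathcal M$ be any $\varepsilon$-differentially private $(\alpha,\beta)$-stopping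 rule for the range $[-R,R]$, and let $\mathcal D$ be any probability distribution supported in $[-R,R]$ with mean $\mu\neq 0$. Then, on i.i.d. samples from $\mathcal D$, with probability greater than $\tfrac14$ the algorithm $\mathcal M$ does not halt within the first $$ c\cdot\frac{R\log(1/\beta)}{\varepsilon\,\alpha\,|\mu|} $$ samples. That is, the sample complexity of $\mathcal M$ is $\Omega\!\left(\frac{R\log(1/\beta)}{\varepsilon\alpha|\mu|}\right)$. -/

import Mathlib

open MeasureTheory
open scoped ENNReal

noncomputable section

/-- A decision made at one timestep: `Sum.inl ()` means "release nothing and continue",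
`Sum.inr x` means "halt now and release the estimate `x`". -/
abbrev Decision : Type := Unit ⊕ ℝ

/-- A randomized streaming algorithm that reads real samples `s 0, s 1, …` one at a time.
All of its internal randomness is a seed `ω : Ω`, drawn once from the probability measure `coins`
independently of the samples. The decision after `t` samples is a measurable function of the first
`t` samples and of the seed only. -/
structure StreamAlgorithm (Ω : Type*) [MeasurableSpace Ω] where
  /-- the law of the internal randomness -/
  coins : Measure Ω
  /-- it is a probability measure -/
  isProb : IsProbabilityMeasure coins
  /-- what the algorithm does after `t` samples if it has not halted before -/
  step : (t : ℕ) → (Fin t → ℝ) × Ω → Decision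
  /-- the algorithm is measurable -/
  measurable_step : ∀ t, Measurable (step t)

namespace StreamAlgorithm

variable {Ω : Type*} [MeasurableSpace Ω]

/-- What the algorithm would do after reading the first `t` samples of the stream `s`,
if it is still running. -/
def rawDecision (M : StreamAlgorithm Ω) (s : ℕ → ℝ) (ω : Ω) (t : ℕ) : Decision :=
  M.step t (fun i : Fin t => s i, ω)

open Classical in
/-- The decision that is actually observed at timestep `t` (after `t` samples): once the algorithm
has halted, it releases nothing any more. -/
def decision (M : StreamAlgorithm Ω) (s : ℕ → ℝ) (ω : Ω) (t : ℕ) : Decision :=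
  if ∀ t' < t, M.rawDecision s ω t' = Sum.inl () then M.rawDecision s ω t else Sum.inl ()

/-- On the stream `s` and seed `ω`, the algorithm halts after exactly `t` samples
and releases `x`. -/
def HaltsWith (M : StreamAlgorithm Ω) (s : ℕ → ℝ) (ω : Ω) (t : ℕ) (x : ℝ) : Prop :=
  M.decision s ω t = Sum.inr x

/-- All decisions released up to and including timestep `T`. -/
def transcript (M : StreamAlgorithm Ω) (T : ℕ) (s : ℕ → ℝ) (ω : Ω) : Fin (T + 1) → Decision :=
  fun t => M.decision s ω t

/-- Event-level `ε`-differential privacy under continual observation, for streams with entries in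
`[-R, R]`: for two streams that agree outside a single timestep, and for every horizon `T` and every
measurable set `O` of decision sequences through `T`, the probabilities (over the internal
randomness) of `O` are within a factor `exp ε`. -/
def IsDP (M : StreamAlgorithm Ω) (R ε : ℝ) : Prop :=
  ∀ s s' : ℕ → ℝ, (∀ i, s i ∈ Set.Icc (-R) R) → (∀ i, s' i ∈ Set.Icc (-R) R) →
    (∃ i, ∀ j, j ≠ i → s j = s' j) →
    ∀ (T : ℕ) (O : Set (Fin (T + 1) → Decision)), MeasurableSet O →
      M.coins {ω | M.transcript T s ω ∈ O} ≤
        ENNReal.ofReal (Real.exp ε) * M.coins {ω | M.transcript T s' ω ∈ O}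

/-- The joint law of the stream and of the seed when the samples are i.i.d. with law `D` and
independent of the internal randomness. -/
def law (M : StreamAlgorithm Ω) (D : Measure ℝ) : Measure ((ℕ → ℝ) × Ω) :=
  (Measure.infinitePi (fun _ : ℕ => D)).prod M.coins

/-- `(α, β)`-stopping rule for the a-priori known range `[-R, R]`: for every distribution `D` on
`[-R, R]` with nonzero mean `m`, run on i.i.d. samples from `D`, the probability that the algorithm
halts and releases an `x` with `|x - m| > α |m|` is less than `β`. Running on without ever
halting is not counted as an error, so this includes all rules that halt almost surely. -/
def IsStoppingRule (M : StreamAlgorithm Ω) (R α β : ℝ) : Prop :=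
  ∀ D : Measure ℝ, IsProbabilityMeasure D → (∀ᵐ x ∂D, x ∈ Set.Icc (-R) R) → (∫ x, x ∂D) ≠ 0 →
    M.law D {p | ∃ t x, M.HaltsWith p.1 p.2 t x ∧ α * |∫ y, y ∂D| < |x - ∫ y, y ∂D|}
      < ENNReal.ofReal β

/-- The event that the algorithm is still running after every number `t ≤ n` of samples, i.e. that
it uses strictly more than `n` samples. -/
def usesMoreThan (M : StreamAlgorithm Ω) (n : ℝ) : Set ((ℕ → ℝ) × Ω) :=
  {p | ∀ (t : ℕ) (x : ℝ), (t : ℝ) ≤ n → ¬ M.HaltsWith p.1 p.2 t x}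

end StreamAlgorithm

end

noncomputable section

namespace StreamAlgorithm

variable {Ω : Type*} [MeasurableSpace Ω]

/-! Replace each sample, independently with probability `p`, by the endpoint of `[-R, R]` whose sign
is opposite to that of the mean `m`. A suitable `p` of order `α|m|/R` shrinks the mean so far that
no estimate is `α`-accurate for both means (`relative_error_of_shifted_mean`). Halting with an
estimate accurate for `m` is then an error under the contaminated law, hence has probability below
`β` there.

Among `N` samples about `N p` are replaced. If fewer than `a = log(1/β)/(4ε)` are, group privacy
costs at most a factor `exp(εa) = β^(-1/4)`; Markov's inequality bounds the remaining probability by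
`1/8` (`IsDP.law_fst_le`). So under the original law, an accurate release within `N` samples has
probability below `β^(3/4) + 1/8`, a wrong release less than `β`, and more than `1/4` is left for
not halting. -/

/-! ### Locality and measurability of transcripts -/

lemma rawDecision_congr (M : StreamAlgorithm Ω) {s s' : ℕ → ℝ} {t : ℕ}
    (h : ∀ i < t, s i = s' i) (ω : Ω) : M.rawDecision s ω t = M.rawDecision s' ω t := by
  have : (fun i : Fin t => s i) = fun i : Fin t => s' i := funext fun i => h i i.2
  simp only [rawDecision, this]

/-- Decision `t` sees only the samples with index below `t`, so the `T + 1` decisions through time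
`T` depend on just `T` samples. -/
lemma transcript_congr (M : StreamAlgorithm Ω) {s s' : ℕ → ℝ} {T : ℕ}
    (h : ∀ i < T, s i = s' i) (ω : Ω) : M.transcript T s ω = M.transcript T s' ω := by
  classical
  funext t
  have ht : (t : ℕ) ≤ T := Nat.lt_succ_iff.1 t.2
  have key : ∀ u ≤ (t : ℕ), M.rawDecision s ω u = M.rawDecision s' ω u := fun u hu =>
    M.rawDecision_congr (fun i hi => h i (by omega)) ω
  have hcond : (∀ u < (t : ℕ), M.rawDecision s ω u = Sum.inl ()) ↔
      ∀ u < (t : ℕ), M.rawDecision s' ω u = Sum.inl () :=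
    forall₂_congr fun u hu => by rw [key u hu.le]
  simp only [transcript, decision, hcond, key t le_rfl]

lemma measurable_rawDecision (M : StreamAlgorithm Ω) (t : ℕ) :
    Measurable fun p : (ℕ → ℝ) × Ω => M.rawDecision p.1 p.2 t :=
  (M.measurable_step t).comp (by fun_prop)

lemma measurableSet_singleton_inl : MeasurableSet ({Sum.inl ()} : Set Decision) := by
  rw [← Set.image_singleton]
  exact (measurableSet_singleton ()).inl_image

lemma measurable_transcript (M : StreamAlgorithm Ω) (T : ℕ) :
    Measurable fun p : (ℕ → ℝ) × Ω => M.transcript T p.1 p.2 := by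
  classical
  refine measurable_pi_lambda _ fun t => ?_
  have hset : MeasurableSet
      {p : (ℕ → ℝ) × Ω | ∀ u < (t : ℕ), M.rawDecision p.1 p.2 u = Sum.inl ()} := by
    simp only [Set.ofPred_forall]
    exact MeasurableSet.iInter fun u => MeasurableSet.iInter fun _ =>
      M.measurable_rawDecision u measurableSet_singleton_inl
  unfold transcript decision
  exact Measurable.ite hset (M.measurable_rawDecision t) measurable_const

/-! ### Group privacy and its transfer to i.i.d. streams -/

/-- Group privacy. -/
lemma IsDP.coins_le_pow_card {M : StreamAlgorithm Ω} {R ε : ℝ} (hM : M.IsDP R ε) {T : ℕ}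
    {O : Set (Fin (T + 1) → Decision)} (hO : MeasurableSet O) {s' : ℕ → ℝ}
    (hs' : ∀ i, s' i ∈ Set.Icc (-R) R) (F : Finset ℕ) :
    ∀ s : ℕ → ℝ, (∀ i, s i ∈ Set.Icc (-R) R) → (∀ j ∉ F, s j = s' j) →
      M.coins {ω | M.transcript T s ω ∈ O} ≤
        ENNReal.ofReal (Real.exp ε) ^ F.card * M.coins {ω | M.transcript T s' ω ∈ O} := by
  classical
  induction F using Finset.induction_on with
  | empty =>
    intro s _ h
    have : s = s' := funext fun j => h j (by simp)
    simp [this]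
  | insert a F ha ih =>
    intro s hs h
    have hu : ∀ i, Function.update s a (s' a) i ∈ Set.Icc (-R) R := by
      intro i
      by_cases hi : i = a
      · subst hi; simpa using hs' i
      · simpa [hi] using hs i
    have h1 := hM s (Function.update s a (s' a)) hs hu
      ⟨a, fun j hj => by simp [hj]⟩ T O hO
    have h2 := ih (Function.update s a (s' a)) hu (fun j hj => by
      by_cases hja : j = a
      · subst hja; simp
      · simpa [hja] using h j (by simp [hja, hj]))
    calc _ ≤ _ := h1
      _ ≤ _ := mul_le_mul_right h2 _
      _ = _ := by rw [Finset.card_insert_of_notMem ha, pow_succ]; ring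

open Classical in
/-- Number of disagreements among the first `N` entries of two streams. -/
def disagreements (N : ℕ) (z : ℕ → ℝ × ℝ) : Finset ℕ :=
  (Finset.range N).filter fun i => (z i).1 ≠ (z i).2

lemma measurableSet_fst_ne_snd : MeasurableSet {q : ℝ × ℝ | q.1 ≠ q.2} :=
  (measurableSet_eq_fun measurable_fst measurable_snd).compl

lemma card_disagreements_eq_sum (N : ℕ) (z : ℕ → ℝ × ℝ) :
    ((disagreements N z).card : ℝ≥0∞) =
      ∑ i ∈ Finset.range N, {q : ℝ × ℝ | q.1 ≠ q.2}.indicator 1 (z i) := by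
  classical
  simp only [disagreements, Finset.card_filter, Set.indicator_apply, Pi.one_apply, Set.mem_ofPred_eq]
  push_cast
  rfl

lemma measurable_card_disagreements (N : ℕ) :
    Measurable fun z => ((disagreements N z).card : ℝ≥0∞) := by
  simp only [card_disagreements_eq_sum]
  exact Finset.measurable_fun_sum _ fun i _ =>
    (measurable_one.indicator measurableSet_fst_ne_snd).comp (measurable_pi_apply i)

lemma lintegral_card_disagreements (Q : Measure (ℝ × ℝ)) [IsProbabilityMeasure Q] (N : ℕ) :
    ∫⁻ z, ((disagreements N z).card : ℝ≥0∞) ∂(Measure.infinitePi fun _ : ℕ => Q) =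
      N * Q {q | q.1 ≠ q.2} := by
  simp only [card_disagreements_eq_sum]
  have hm : Measurable ({q : ℝ × ℝ | q.1 ≠ q.2}.indicator (1 : ℝ × ℝ → ℝ≥0∞)) :=
    measurable_one.indicator measurableSet_fst_ne_snd
  rw [lintegral_finsetSum _ fun i _ => by exact hm.comp (measurable_pi_apply i)]
  have : ∀ i : ℕ, ∫⁻ z, {q : ℝ × ℝ | q.1 ≠ q.2}.indicator (1 : ℝ × ℝ → ℝ≥0∞) (z i)
      ∂(Measure.infinitePi fun _ : ℕ => Q) = Q {q | q.1 ≠ q.2} := fun i => by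
    rw [(measurePreserving_eval_infinitePi (fun _ : ℕ => Q) i).lintegral_comp hm,
      lintegral_indicator_one measurableSet_fst_ne_snd]
  simp [this]

lemma IsDP.coins_le_exp_card {M : StreamAlgorithm Ω} {R ε : ℝ} (hM : M.IsDP R ε) {N : ℕ}
    {O : Set (Fin (N + 1) → Decision)} (hO : MeasurableSet O) {z : ℕ → ℝ × ℝ}
    (h₁ : ∀ i, (z i).1 ∈ Set.Icc (-R) R) (h₂ : ∀ i, (z i).2 ∈ Set.Icc (-R) R) :
    M.coins {ω | M.transcript N (fun i => (z i).1) ω ∈ O} ≤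
      ENNReal.ofReal (Real.exp (ε * (disagreements N z).card)) *
        M.coins {ω | M.transcript N (fun i => (z i).2) ω ∈ O} := by
  classical
  have hpow : ENNReal.ofReal (Real.exp (ε * (disagreements N z).card)) =
      ENNReal.ofReal (Real.exp ε) ^ (disagreements N z).card := by
    rw [← ENNReal.ofReal_pow (Real.exp_pos ε).le, ← Real.exp_nat_mul, mul_comm]
  -- Splicing in the first stream from index `N` on leaves the transcript unchanged and makes the
  -- two streams differ only on the finite set `disagreements N z`.
  have htr : ∀ ω, M.transcript N (fun i => (z i).2) ω =
      M.transcript N (fun i => if i < N then (z i).2 else (z i).1) ω :=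
    fun ω => M.transcript_congr (fun i hi => by simp [hi]) ω
  simp only [htr, hpow]
  refine hM.coins_le_pow_card hO (fun i => ?_) _ _ h₁ fun j hj => ?_
  · split_ifs
    exacts [h₂ i, h₁ i]
  · by_cases hjN : j < N
    · have : (z j).1 = (z j).2 := by
        by_contra hne; exact hj (by simp [disagreements, hjN, hne])
      simp [hjN, this]
    · simp [hjN]

lemma isProbabilityMeasure_law (M : StreamAlgorithm Ω) (D : Measure ℝ) [IsProbabilityMeasure D] :
    IsProbabilityMeasure (M.law D) := by
  have := M.isProb
  unfold law; infer_instance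

/-- Privacy transfers events between the i.i.d. laws of the two marginals of a coupling. -/
lemma IsDP.law_fst_le {M : StreamAlgorithm Ω} {R ε : ℝ} (hε : 0 < ε) (hM : M.IsDP R ε) (N : ℕ)
    {O : Set (Fin (N + 1) → Decision)} (hO : MeasurableSet O)
    (Q : Measure (ℝ × ℝ)) [IsProbabilityMeasure Q]
    (h₁ : ∀ᵐ q ∂Q, q.1 ∈ Set.Icc (-R) R) (h₂ : ∀ᵐ q ∂Q, q.2 ∈ Set.Icc (-R) R)
    {a : ℝ} (ha : 0 < a) :
    M.law (Q.map Prod.fst) {p | M.transcript N p.1 p.2 ∈ O} ≤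
      ENNReal.ofReal (Real.exp (ε * a)) *
          M.law (Q.map Prod.snd) {p | M.transcript N p.1 p.2 ∈ O} +
        N * Q {q | q.1 ≠ q.2} / ENNReal.ofReal a := by
  have := M.isProb
  have hE : MeasurableSet {p : (ℕ → ℝ) × Ω | M.transcript N p.1 p.2 ∈ O} :=
    M.measurable_transcript N hO
  have hg : Measurable fun s : ℕ → ℝ => M.coins {ω | M.transcript N s ω ∈ O} :=
    measurable_measure_prodMk_left hE
  have hlaw : ∀ f : ℝ × ℝ → ℝ, Measurable f →
      M.law (Q.map f) {p | M.transcript N p.1 p.2 ∈ O} =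
        ∫⁻ z, M.coins {ω | M.transcript N (fun i => f (z i)) ω ∈ O}
          ∂(Measure.infinitePi fun _ : ℕ => Q) := by
    intro f hf
    have : IsProbabilityMeasure (Q.map f) := Measure.isProbabilityMeasure_map hf.aemeasurable
    rw [law, Measure.prod_apply hE,
      ← Measure.infinitePi_map_pi (μ := fun _ : ℕ => Q) (f := fun _ => f) (fun _ => hf)]
    exact lintegral_map hg (by fun_prop)
  have hae : ∀ S : Set (ℝ × ℝ), (∀ᵐ q ∂Q, q ∈ S) →
      ∀ᵐ z ∂(Measure.infinitePi fun _ : ℕ => Q), ∀ i, z i ∈ S := fun S hS =>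
    ae_all_iff.2 fun i =>
      (measurePreserving_eval_infinitePi (fun _ : ℕ => Q) i).quasiMeasurePreserving.ae hS
  -- On `B`, the paths with at least `a` disagreements, the probability is bounded trivially by 1;
  -- Markov's inequality controls the mass of `B`. Off `B`, group privacy applies.
  set B : Set (ℕ → ℝ × ℝ) := {z | ENNReal.ofReal a ≤ ((disagreements N z).card : ℝ≥0∞)} with hB
  have hBm : MeasurableSet B := measurableSet_le measurable_const (measurable_card_disagreements N)
  have hmarkov : Measure.infinitePi (fun _ : ℕ => Q) B ≤
      N * Q {q | q.1 ≠ q.2} / ENNReal.ofReal a := by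
    rw [← lintegral_card_disagreements]
    exact meas_ge_le_lintegral_div (measurable_card_disagreements N).aemeasurable
      (by simpa using ha) ENNReal.ofReal_ne_top
  have hg₂ : Measurable fun z : ℕ → ℝ × ℝ =>
      M.coins {ω | M.transcript N (fun i => (z i).2) ω ∈ O} := hg.comp (by fun_prop)
  rw [hlaw _ measurable_fst, hlaw _ measurable_snd]
  calc _ ≤ ∫⁻ z, (ENNReal.ofReal (Real.exp (ε * a)) *
        M.coins {ω | M.transcript N (fun i => (z i).2) ω ∈ O} + B.indicator 1 z)
          ∂(Measure.infinitePi fun _ : ℕ => Q) := by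
        refine lintegral_mono_ae ?_
        filter_upwards [hae _ h₁, hae _ h₂] with z hz₁ hz₂
        by_cases hz : z ∈ B
        · simp only [hz, Set.indicator_of_mem, Pi.one_apply]
          exact prob_le_one.trans le_add_self
        · simp only [hz, not_false_eq_true, Set.indicator_of_notMem, add_zero]
          refine (hM.coins_le_exp_card hO hz₁ hz₂).trans ?_
          have hlt : ((disagreements N z).card : ℝ) < a := by
            by_contra! hcon
            refine hz ?_
            rw [hB, Set.mem_ofPred_eq, ← ENNReal.ofReal_natCast]
            exact ENNReal.ofReal_le_ofReal hcon
          gcongr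
    _ = _ + Measure.infinitePi (fun _ : ℕ => Q) B := by
        rw [lintegral_add_right _ (measurable_one.indicator hBm), lintegral_indicator_one hBm,
          lintegral_const_mul _ hg₂]
    _ ≤ _ := by gcongr

/-- The decision sequences that contain a release in `S`. -/
def releasesIn (T : ℕ) (S : Set ℝ) : Set (Fin (T + 1) → Decision) :=
  ⋃ t, (fun d => d t) ⁻¹' (Sum.inr '' S)

lemma measurableSet_releasesIn (T : ℕ) {S : Set ℝ} (hS : MeasurableSet S) :
    MeasurableSet (releasesIn T S) :=
  MeasurableSet.iUnion fun t =>
    measurable_pi_apply t (measurableSet_inr_image.2 hS)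

lemma transcript_mem_releasesIn {M : StreamAlgorithm Ω} {T : ℕ} {S : Set ℝ} {s : ℕ → ℝ} {ω : Ω} :
    M.transcript T s ω ∈ releasesIn T S ↔ ∃ t ≤ T, ∃ x ∈ S, M.HaltsWith s ω t x := by
  simp only [releasesIn, Set.mem_iUnion, Set.mem_preimage, Set.mem_image, transcript, HaltsWith]
  constructor
  · rintro ⟨t, x, hx, h⟩
    exact ⟨t, Nat.lt_succ_iff.1 t.2, x, hx, h.symm⟩
  · rintro ⟨t, ht, x, hx, h⟩
    exact ⟨⟨t, Nat.lt_succ_iff.2 ht⟩, x, hx, h.symm⟩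

end StreamAlgorithm

/-! ### The contaminated distribution -/

/-- The coupling of `D` with `(1 - p) D + p δ_r` in which the second coordinate
is replaced by `r` with probability `p`. -/
def contaminationCoupling (D : Measure ℝ) (p r : ℝ) : Measure (ℝ × ℝ) :=
  ENNReal.ofReal (1 - p) • D.map (fun x => (x, x)) + ENNReal.ofReal p • D.map (fun x => (x, r))

section contaminationCoupling

variable {D : Measure ℝ} {p r : ℝ}

lemma isProbabilityMeasure_contaminationCoupling [IsProbabilityMeasure D] (hp₀ : 0 ≤ p) (hp₁ : p ≤ 1) :
    IsProbabilityMeasure (contaminationCoupling D p r) := by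
  constructor
  have h₁ : Measurable fun x : ℝ => (x, x) := by fun_prop
  have h₂ : Measurable fun x : ℝ => (x, r) := by fun_prop
  simp only [contaminationCoupling, Measure.add_apply, Measure.smul_apply, smul_eq_mul,
    Measure.map_apply h₁ .univ, Measure.map_apply h₂ .univ, Set.preimage_univ, measure_univ,
    mul_one]
  rw [← ENNReal.ofReal_add (by linarith) hp₀]
  simp

lemma map_fst_contaminationCoupling (hp₀ : 0 ≤ p) (hp₁ : p ≤ 1) :
    (contaminationCoupling D p r).map Prod.fst = D := by
  rw [contaminationCoupling, Measure.map_add _ _ measurable_fst, Measure.map_smul,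
    Measure.map_smul, Measure.map_map measurable_fst (by fun_prop),
    Measure.map_map measurable_fst (by fun_prop)]
  simp only [Function.comp_def, Measure.map_id']
  rw [← add_smul, ← ENNReal.ofReal_add (by linarith) hp₀]
  simp

lemma map_snd_contaminationCoupling [IsProbabilityMeasure D] :
    (contaminationCoupling D p r).map Prod.snd =
      ENNReal.ofReal (1 - p) • D + ENNReal.ofReal p • Measure.dirac r := by
  rw [contaminationCoupling, Measure.map_add _ _ measurable_snd, Measure.map_smul,
    Measure.map_smul, Measure.map_map measurable_snd (by fun_prop),
    Measure.map_map measurable_snd (by fun_prop)]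
  simp [Function.comp_def, Measure.map_const]

/-- Only an inequality, since `D` may have an atom at `r`. -/
lemma contaminationCoupling_fst_ne_snd_le [IsProbabilityMeasure D] :
    contaminationCoupling D p r {q | q.1 ≠ q.2} ≤ ENNReal.ofReal p := by
  have h₁ : Measurable fun x : ℝ => (x, x) := by fun_prop
  rw [contaminationCoupling, Measure.add_apply, Measure.smul_apply, Measure.smul_apply,
    Measure.map_apply h₁ StreamAlgorithm.measurableSet_fst_ne_snd]
  have : IsProbabilityMeasure (D.map fun x : ℝ => (x, r)) :=
    Measure.isProbabilityMeasure_map (by fun_prop)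
  simp only [Set.preimage_ofPred_eq, ne_eq, not_true_eq_false, Set.ofPred_false, measure_empty,
    smul_eq_mul, mul_zero, zero_add]
  exact mul_le_of_le_one_right' prob_le_one

lemma integral_contaminated (hD : Integrable (fun x => x) D) (hp₀ : 0 ≤ p) (hp₁ : p ≤ 1) :
    ∫ x, x ∂(ENNReal.ofReal (1 - p) • D + ENNReal.ofReal p • Measure.dirac r) =
      (1 - p) * ∫ x, x ∂D + p * r := by
  have hdirac : Integrable (fun x : ℝ => x) (Measure.dirac r) :=
    integrable_dirac (by simp)
  rw [integral_add_measure (hD.smul_measure ENNReal.ofReal_ne_top)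
    (hdirac.smul_measure ENNReal.ofReal_ne_top), integral_smul_measure, integral_smul_measure,
    ENNReal.toReal_ofReal (by linarith), ENNReal.toReal_ofReal hp₀]
  simp

lemma ae_contaminated {S : Set ℝ} (hS : MeasurableSet S) (hD : ∀ᵐ x ∂D, x ∈ S) (hr : r ∈ S) :
    ∀ᵐ x ∂(ENNReal.ofReal (1 - p) • D + ENNReal.ofReal p • Measure.dirac r), x ∈ S := by
  rw [ae_add_measure_iff]
  exact ⟨Measure.ae_smul_measure hD _, Measure.ae_smul_measure ((ae_dirac_iff hS).2 hr) _⟩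

end contaminationCoupling

/-! ### Numerical estimates -/

/-- If the mean moves from `m` to `(1 - 2α / (1 + α²)) m`, no number is within
relative error `α` of both. -/
lemma relative_error_of_shifted_mean {α m m' x : ℝ} (hα₀ : 0 < α) (hα₁ : α < 1) (hm : m ≠ 0)
    (hm' : m' = (1 - 2 * α / (1 + α ^ 2)) * m) (hx : |x - m| ≤ α * |m|) :
    α * |m'| < |x - m'| := by
  have hq : 0 < 1 + α ^ 2 := by positivity
  set l := 1 - 2 * α / (1 + α ^ 2) with hl
  have hleq : l * (1 + α ^ 2) = (1 - α) ^ 2 := by rw [hl]; field_simp; ring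
  have hlpos : 0 < l := by
    have : 0 < (1 - α) ^ 2 := by have : 0 < 1 - α := by linarith
                                 positivity
    nlinarith
  have hmpos : 0 < |m| := abs_pos.2 hm
  -- Since `l = (1 - α)² / (1 + α²)`, this amounts to `1 - α² < 1 + α²`. It says that the two
  -- intervals of accurate estimates are disjoint.
  have hsep : l * (1 + α) < 1 - α := by
    have : l * (1 + α) * (1 + α ^ 2) < (1 - α) * (1 + α ^ 2) := by
      have : l * (1 + α) * (1 + α ^ 2) = (1 - α) ^ 2 * (1 + α) := by rw [← hleq]; ring
      rw [this]
      nlinarith [mul_pos hα₀ (sub_pos.2 hα₁), mul_pos (mul_pos hα₀ hα₀) (sub_pos.2 hα₁)]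
    exact lt_of_mul_lt_mul_right this hq.le
  have habs : |m'| = l * |m| := by rw [hm', abs_mul, abs_of_pos hlpos]
  have hdiff : |m - m'| = (1 - l) * |m| := by
    have : m - m' = (1 - l) * m := by rw [hm']; ring
    rw [this, abs_mul, abs_of_nonneg]
    rw [hl]; ring_nf; positivity
  have htri : |m - m'| ≤ |x - m| + |x - m'| := by
    have := abs_sub_le m x m'
    rwa [abs_sub_comm m x] at this
  rw [habs]
  nlinarith

/-- The left side is `β^(3/4)`. Comparing fourth powers, `β³ ≤ 1/64 < (3/8)^4`, and `3/8` is below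
the right side because `β < 1/4`. -/
lemma mul_exp_log_inv_div_four_le {β : ℝ} (h₀ : 0 < β) (h₁ : β < 1 / 4) :
    β * Real.exp (Real.log (1 / β) / 4) ≤ 3 / 4 - β - 1 / 8 := by
  have hexp : Real.exp (Real.log (1 / β) / 4) ^ 4 = 1 / β := by
    rw [← Real.exp_nat_mul]
    push_cast
    rw [mul_div_cancel₀ _ (by norm_num), Real.exp_log (by positivity)]
  set e := Real.exp (Real.log (1 / β) / 4) with he
  have he0 : 0 < e := Real.exp_pos _
  have h4 : (β * e) ^ 4 = β ^ 3 := by rw [mul_pow, hexp]; field_simp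
  have h3 : β ^ 3 ≤ (1 / 4) ^ 3 := by gcongr
  have : β * e ≤ 3 / 8 := by
    refine le_of_pow_le_pow_left₀ (n := 4) (by norm_num) (by norm_num) ?_
    rw [h4]; refine h3.trans (by norm_num)
  linarith

end

/-! ### The lower bound -/

theorem theorem3 :
    ∃ c : ℝ, 0 < c ∧
      ∀ (R ε α β : ℝ), 0 < R → 0 < ε → 0 < α → α < 1 → 0 < β → β < 1 / 4 →
      ∀ (Ω : Type*) [MeasurableSpace Ω] (M : StreamAlgorithm Ω),
        M.IsDP R ε → M.IsStoppingRule R α β →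
      ∀ (D : Measure ℝ), IsProbabilityMeasure D → (∀ᵐ x ∂D, x ∈ Set.Icc (-R) R) →
        (∫ x, x ∂D) ≠ 0 →
        1 / 4 < M.law D
          (M.usesMoreThan (c * (R * Real.log (1 / β) / (ε * α * |∫ x, x ∂D|)))) := by
  -- With `p ≤ 2α|m|/R`, the constant `1/64` gives `N p ≤ log(1/β)/(32ε) = a/8`, which Markov's
  -- inequality turns into `1/8`.
  refine ⟨1 / 64, by norm_num, ?_⟩
  intro R ε α β hR hε hα₀ hα₁ hβ₀ hβ₁ Ω _ M hDP hRule D hD hsupp hm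
  set m : ℝ := ∫ x, x ∂D with hmdef
  have hmpos : 0 < |m| := abs_pos.2 hm
  have hlog : 0 < Real.log (1 / β) := Real.log_pos (by rw [lt_div_iff₀ hβ₀]; linarith)
  set n : ℝ := 1 / 64 * (R * Real.log (1 / β) / (ε * α * |m|)) with hn
  have hn0 : 0 ≤ n := by positivity
  set N : ℕ := ⌊n⌋₊ with hN
  have hNn : (N : ℝ) ≤ n := Nat.floor_le hn0
  set l : ℝ := 2 * α / (1 + α ^ 2) with hl
  have hl0 : 0 < l := by positivity
  have hl1 : l ≤ 1 := by rw [hl, div_le_one (by positivity)]; nlinarith [sq_nonneg (1 - α)]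
  have hl2 : l ≤ 2 * α := div_le_self (by positivity) (by nlinarith [sq_nonneg α])
  -- The far endpoint lies at distance `|m| + R` from `m`, so this `p` moves the mean by exactly `l
  -- * |m|` towards zero.
  set p : ℝ := l * |m| / (|m| + R) with hp
  have hp0 : 0 ≤ p := by positivity
  have hp1 : p ≤ 1 := by rw [hp, div_le_one (by positivity)]; nlinarith
  have hp2 : p ≤ 2 * α * |m| / R := by rw [hp]; gcongr; linarith
  obtain ⟨r, hr, hmean⟩ : ∃ r ∈ Set.Icc (-R) R, (1 - p) * m + p * r = (1 - l) * m := by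
    have hpR : p * (|m| + R) = l * |m| := by rw [hp]; field_simp
    rcases lt_or_gt_of_ne hm with h | h
    · refine ⟨R, ⟨by linarith, le_rfl⟩, ?_⟩
      rw [abs_of_neg h] at hpR
      linarith
    · refine ⟨-R, ⟨le_rfl, by linarith⟩, ?_⟩
      rw [abs_of_pos h] at hpR
      linarith
  have hQ : IsProbabilityMeasure (contaminationCoupling D p r) :=
    isProbabilityMeasure_contaminationCoupling hp0 hp1
  have hfst := map_fst_contaminationCoupling (D := D) (r := r) hp0 hp1
  have hsnd := map_snd_contaminationCoupling (D := D) (p := p) (r := r)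
  set Q := contaminationCoupling D p r with hQdef
  set D' : Measure ℝ := Q.map Prod.snd with hD'
  have hD'prob : IsProbabilityMeasure D' :=
    Measure.isProbabilityMeasure_map measurable_snd.aemeasurable
  have hsupp' : ∀ᵐ x ∂D', x ∈ Set.Icc (-R) R := by
    rw [hsnd]; exact ae_contaminated measurableSet_Icc hsupp hr
  have hint : Integrable (fun x : ℝ => x) D :=
    Integrable.of_mem_Icc (-R) R aemeasurable_id hsupp
  have hm' : ∫ x, x ∂D' = (1 - l) * m := by
    rw [hsnd, integral_contaminated hint hp0 hp1, hmean]
  have hm'0 : ∫ x, x ∂D' ≠ 0 := by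
    rw [hm']
    refine mul_ne_zero (ne_of_gt ?_) hm
    have : l < 1 := by
      rw [hl, div_lt_one (by positivity)]
      nlinarith [sq_pos_of_pos (sub_pos.2 hα₁)]
    linarith
  have herr := hRule D hD hsupp hm
  have herr' := hRule D' hD'prob hsupp' hm'0
  set S : Set ℝ := {x | |x - m| ≤ α * |m|} with hS
  have hSm : MeasurableSet S := measurableSet_le (by fun_prop) (by fun_prop)
  set E : Set ((ℕ → ℝ) × Ω) :=
    {q | M.transcript N q.1 q.2 ∈ StreamAlgorithm.releasesIn N S} with hE
  have hE' : M.law D' E < ENNReal.ofReal β := by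
    refine (measure_mono ?_).trans_lt herr'
    intro q hq
    obtain ⟨t, -, x, hx, h⟩ := StreamAlgorithm.transcript_mem_releasesIn.1 hq
    exact ⟨t, x, h, relative_error_of_shifted_mean hα₀ hα₁ hm hm' hx⟩
  set a : ℝ := Real.log (1 / β) / (4 * ε) with ha
  have ha0 : 0 < a := by positivity
  have htrans : M.law D E ≤ ENNReal.ofReal (Real.exp (ε * a)) * M.law D' E +
      N * Q {q | q.1 ≠ q.2} / ENNReal.ofReal a := by
    have h := hDP.law_fst_le hε N (StreamAlgorithm.measurableSet_releasesIn N hSm) Q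
      (ae_of_ae_map measurable_fst.aemeasurable (by rw [hfst]; exact hsupp))
      (ae_of_ae_map measurable_snd.aemeasurable hsupp') ha0
    rwa [hfst] at h
  have hεa : ε * a = Real.log (1 / β) / 4 := by rw [ha]; field_simp
  have hmarkov : (N : ℝ≥0∞) * Q {q | q.1 ≠ q.2} / ENNReal.ofReal a ≤ ENNReal.ofReal (1 / 8) := by
    refine ENNReal.div_le_of_le_mul ?_
    calc (N : ℝ≥0∞) * Q {q | q.1 ≠ q.2} ≤ ENNReal.ofReal N * ENNReal.ofReal p := by
          rw [ENNReal.ofReal_natCast]; gcongr; exact contaminationCoupling_fst_ne_snd_le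
      _ = ENNReal.ofReal (N * p) := (ENNReal.ofReal_mul (Nat.cast_nonneg N)).symm
      _ ≤ ENNReal.ofReal (1 / 8 * a) := by
          refine ENNReal.ofReal_le_ofReal ?_
          calc (N : ℝ) * p ≤ n * (2 * α * |m| / R) := by gcongr
            _ = 1 / 8 * a := by rw [hn, ha]; field_simp; ring
      _ = _ := ENNReal.ofReal_mul (by norm_num)
  by_contra! hcon
  have hprob : IsProbabilityMeasure (M.law D) := M.isProbabilityMeasure_law D
  -- Every run outlasts `n` samples, halts by time `N` with an accurate estimate, or releases a
  -- wrong one.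
  have hcover : (Set.univ : Set ((ℕ → ℝ) × Ω)) ⊆ M.usesMoreThan n ∪ (E ∪
      {q | ∃ t x, M.HaltsWith q.1 q.2 t x ∧ α * |m| < |x - m|}) := by
    intro q _
    by_cases hq : q ∈ M.usesMoreThan n
    · exact Or.inl hq
    · simp only [StreamAlgorithm.usesMoreThan, Set.mem_ofPred_eq] at hq
      push Not at hq
      obtain ⟨t, x, ht, h⟩ := hq
      rcases le_or_gt |x - m| (α * |m|) with hx | hx
      · exact Or.inr (Or.inl (StreamAlgorithm.transcript_mem_releasesIn.2
          ⟨t, Nat.le_floor ht, x, hx, h⟩))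
      · exact Or.inr (Or.inr ⟨t, x, h, hx⟩)
  have hone := calc (1 : ℝ≥0∞) = M.law D Set.univ := measure_univ.symm
    _ ≤ _ := measure_mono hcover
    _ ≤ _ := (measure_union_le _ _).trans (add_le_add le_rfl (measure_union_le _ _))
  have hquarter : (1 / 4 : ℝ≥0∞) = ENNReal.ofReal (1 / 4) := by
    rw [ENNReal.ofReal_div_of_pos (by norm_num)]; simp
  have hbound : M.law D E < ENNReal.ofReal (Real.exp (ε * a) * β + 1 / 8) := by
    refine htrans.trans_lt ?_
    rw [ENNReal.ofReal_add (by positivity) (by norm_num),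
      ENNReal.ofReal_mul (Real.exp_pos _).le]
    refine ENNReal.add_lt_add_of_lt_of_le (ne_top_of_le_ne_top ENNReal.ofReal_ne_top hmarkov)
      ?_ hmarkov
    exact ENNReal.mul_lt_mul_right (by simpa using Real.exp_pos _) ENNReal.ofReal_ne_top hE'
  have hfinal : (1 : ℝ≥0∞) <
      ENNReal.ofReal (1 / 4 + ((Real.exp (ε * a) * β + 1 / 8) + β)) := by
    rw [ENNReal.ofReal_add (by norm_num) (by positivity),
      ENNReal.ofReal_add (by positivity) hβ₀.le, ← hquarter]
    refine hone.trans_lt (ENNReal.add_lt_add_of_le_of_lt ?_ hcon (ENNReal.add_lt_add hbound herr))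
    exact ne_top_of_le_ne_top (by simp) hcon
  rw [← ENNReal.ofReal_one, ENNReal.ofReal_lt_ofReal_iff (by positivity), hεa] at hfinal
  have := mul_exp_log_inv_div_four_le hβ₀ hβ₁
  linarith [mul_comm β (Real.exp (Real.log (1 / β) / 4))]
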